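/- \textbf{Theorem.} A \emph{Cantor fan} is a space homeomorphic to $\bigcup_{c}S_c$, where $c$ ranges over the standard Cantor set in $[0,1]$ and $S_c$ is the straight line segment in the plane from $(0,0)$ to $(c,1)$. For a continuous map $g:Y\to Y$ of a non-empty compact metrizable space, $(Y,g)$ is \emph{transitive} if for all non-empty open $U,V\subseteq Y$ there is an integer $n\ge 0$ with $g^n(U)\cap V\ne\emptyset$; it is \emph{mixing} if for all non-empty open $U,V\subseteq Y$ there is $n_0\ge 0$ such that $g^n(U)\cap V\neq\emptyset$ for every positive integer $n\ge n_0$; and it is \emph{chaotic in the sense of Devaney} if it is transitive and its periodic points (the $p$ with $g^n(p)=p$ for some $n\ge 1$) are dense in $Y$. Let $X=[0,1]\cup[2,3]\cup[4,5]\cup[6,7]\cup[8,9]$ and define $f_1,f_2,f_3:X\to X$ by $f_1(x)=x$, $$f_2(x)=\begin{cases} x+2, & x\in[0,1]\cup[4,5],\\ (x-2)^2, & x\in[2,3],\\ (x-6)^3+4, & x\in[6,7],\\ x, & x\in[8,9],\end{cases}\qquad f_3(x)=\begin{cases} x, & x\in[0,1],\\ x+2, & x\in[2,3]\cup[6,7],\\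 (x-4)^{1/2}+2, & x\in[4,5],\\ (x-8)^{1/3}+6, & x\in[8,9].\end{cases}$$ Let $F=\Gamma(f_1)\cup\Gamma(f_2)\cup\Gamma(f_3)\subseteq X\times X$ be the union of their graphs. Let $X_F^+\subseteq\prod_{i=1}^{\infty}X$ and $X_F\subseteq\prod_{i=-\infty}^{\infty}X$ be the spaces of one-sided, respectively two-sided, sequences with $(x_i,x_{i+1})\in F$ for all $i$ (with the product topology), with the left shift maps $\sigma_F^+$ and $\sigma_F$. On each of these spaces, identify two sequences if they are equal or if all coordinates of both lie in $\{0,2,4,6,8\}$; denote the two equivalence relations by $\sim_+$ and $\sim$, and let $(\sigma_F^+)^\star([x])=[\sigma_F^+(x)]$ and $\sigma_F^\star([x])=[\sigma_F(x)]$ be the induced maps on the quotient spaces. Then $f_1,f_2,f_3$ are homeomorphisms of $X$ onto itself, and for every Cantor fan $C$: \begin{enumerate} \item there is a continuous map $f:C\to C$, which is not a homeomorphism, such that $(C,f)$ is mixing and chaotic in the sense of Devaney; moreover, $f$ can be chosen so that there is a homeomorphism $\varphi:X_F^+/_{\sim_+}\to C$ with $\varphi\circ(\sigma_F^+)^\star=f\circ\varphi$;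 \item there is a homeomorphism $h:C\to C$ such that $(C,h)$ is mixing and chaotic in the sense of Devaney; moreover, $h$ can be chosen so that there is a homeomorphism $\varphi:X_F/_{\sim}\to C$ with $\varphi\circ\sigma_F^\star=h\circ\varphi$. \end{enumerate} -/

import Mathlib

namespace CantorFanChaos

/-! ### Dynamical notions -/

/-- `(Y, g)` is transitive: for all non-empty open `U`, `V` there is a non-negative integer `n`
with `g^n(U) ∩ V ≠ ∅`. -/
def IsTransitiveMap {Y : Type*} [TopologicalSpace Y] (g : Y → Y) : Prop :=
  ∀ U V : Set Y, IsOpen U → IsOpen V → U.Nonempty → V.Nonempty →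
    ∃ n : ℕ, ((g^[n] '' U) ∩ V).Nonempty

/-- `(Y, g)` is (topologically) mixing: for all non-empty open `U`, `V` there is `n₀` such that
`g^n(U) ∩ V ≠ ∅` for every positive integer `n ≥ n₀`. -/
def IsMixingMap {Y : Type*} [TopologicalSpace Y] (g : Y → Y) : Prop :=
  ∀ U V : Set Y, IsOpen U → IsOpen V → U.Nonempty → V.Nonempty →
    ∃ n₀ : ℕ, ∀ n : ℕ, 0 < n → n₀ ≤ n → ((g^[n] '' U) ∩ V).Nonempty

/-- `(Y, g)` is chaotic in the sense of Devaney: it is transitive and its periodic points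
are dense. -/
def IsDevaneyChaotic {Y : Type*} [TopologicalSpace Y] (g : Y → Y) : Prop :=
  IsTransitiveMap g ∧ Dense (Function.periodicPts g)

/-! ### The Cantor fan -/

/-- The union, over the points `c` of the standard Cantor set, of the straight line segments
in the plane from `(0, 0)` to `(c, 1)`. -/
def standardCantorFan : Set (ℝ × ℝ) :=
  ⋃ c ∈ cantorSet, segment ℝ ((0 : ℝ), (0 : ℝ)) (c, (1 : ℝ))

/-- A Cantor fan is a space homeomorphic to the standard one. -/
def IsCantorFan (C : Type*) [TopologicalSpace C] : Prop :=
  Nonempty (C ≃ₜ standardCantorFan)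

/-! ### Mahavier products of relations, and their shift maps -/

section Mahavier

variable {X : Type*}

/-- The (one-sided) Mahavier product `X_F^+`; the sequences are indexed from `0`. -/
def MahavierPlus (F : Set (X × X)) : Type _ :=
  {x : ℕ → X // ∀ i, (x i, x (i + 1)) ∈ F}

/-- The two-sided Mahavier product `X_F`. -/
def Mahavier (F : Set (X × X)) : Type _ :=
  {x : ℤ → X // ∀ i, (x i, x (i + 1)) ∈ F}

/-- The subspace topology of the countable product. -/
instance [TopologicalSpace X] (F : Set (X × X)) : TopologicalSpace (MahavierPlus F) :=
  inferInstanceAs (TopologicalSpace {x : ℕ → X // ∀ i, (x i, x (i + 1)) ∈ F})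

/-- The subspace topology of the countable product. -/
instance [TopologicalSpace X] (F : Set (X × X)) : TopologicalSpace (Mahavier F) :=
  inferInstanceAs (TopologicalSpace {x : ℤ → X // ∀ i, (x i, x (i + 1)) ∈ F})

/-- The shift map `σ_F^+` on `X_F^+`. -/
def shiftPlus (F : Set (X × X)) (x : MahavierPlus F) : MahavierPlus F :=
  ⟨fun i => x.1 (i + 1), fun i => x.2 (i + 1)⟩

/-- The shift map `σ_F` on `X_F`. -/
def shift (F : Set (X × X)) (x : Mahavier F) : Mahavier F :=
  ⟨fun i => x.1 (i + 1), fun i => x.2 (i + 1)⟩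

end Mahavier

/-! ### The relation on five intervals -/

/-- The union of five intervals. -/
def fiveIntervals : Set ℝ :=
  Set.Icc 0 1 ∪ Set.Icc 2 3 ∪ Set.Icc 4 5 ∪ Set.Icc 6 7 ∪ Set.Icc 8 9

theorem mem_fiveIntervals {x : ℝ} :
    x ∈ fiveIntervals ↔ (0 ≤ x ∧ x ≤ 1) ∨ (2 ≤ x ∧ x ≤ 3) ∨ (4 ≤ x ∧ x ≤ 5) ∨
      (6 ≤ x ∧ x ≤ 7) ∨ (8 ≤ x ∧ x ≤ 9) := by
  simp only [fiveIntervals, Set.mem_union, Set.mem_Icc, or_assoc]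

/-- On the five intervals: `x + 2` on `[0,1] ∪ [4,5]`, `(x-2)^2` on `[2,3]`,
`(x-6)^3 + 4` on `[6,7]`, and `x` on `[8,9]`. -/
noncomputable def f₂Real (x : ℝ) : ℝ :=
  if x ≤ 1 then x + 2
  else if x ≤ 3 then (x - 2) ^ 2
  else if x ≤ 5 then x + 2
  else if x ≤ 7 then (x - 6) ^ 3 + 4
  else x

/-- On the five intervals: `x` on `[0,1]`, `x + 2` on `[2,3] ∪ [6,7]`,
`(x-4)^(1/2) + 2` on `[4,5]`, and `(x-8)^(1/3) + 6` on `[8,9]`. -/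
noncomputable def f₃Real (x : ℝ) : ℝ :=
  if x ≤ 1 then x
  else if x ≤ 3 then x + 2
  else if x ≤ 5 then (x - 4) ^ (1 / 2 : ℝ) + 2
  else if x ≤ 7 then x + 2
  else (x - 8) ^ (1 / 3 : ℝ) + 6

theorem f₂Real_mem {x : ℝ} (hx : x ∈ fiveIntervals) : f₂Real x ∈ fiveIntervals := by
  rw [mem_fiveIntervals] at hx ⊢
  unfold f₂Real
  split_ifs with h1 h2 h3 h4
  · right; left
    rcases hx with h | h | h | h | h <;> constructor <;> linarith
  · left
    have h0 : 0 ≤ x - 2 := by rcases hx with h | h | h | h | h <;> linarith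
    exact ⟨by positivity, pow_le_one₀ h0 (by linarith)⟩
  · right; right; right; left
    rcases hx with h | h | h | h | h <;> constructor <;> linarith
  · right; right; left
    have h0 : 0 ≤ x - 6 := by rcases hx with h | h | h | h | h <;> linarith
    have ha : 0 ≤ (x - 6) ^ 3 := by positivity
    have hb : (x - 6) ^ 3 ≤ 1 := pow_le_one₀ h0 (by linarith)
    constructor <;> linarith
  · right; right; right; right
    rcases hx with h | h | h | h | h <;> constructor <;> linarith

theorem f₃Real_mem {x : ℝ} (hx : x ∈ fiveIntervals) : f₃Real x ∈ fiveIntervals := by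
  rw [mem_fiveIntervals] at hx ⊢
  unfold f₃Real
  split_ifs with h1 h2 h3 h4
  · left
    rcases hx with h | h | h | h | h <;> constructor <;> linarith
  · right; right; left
    rcases hx with h | h | h | h | h <;> constructor <;> linarith
  · right; left
    have h0 : 0 ≤ x - 4 := by rcases hx with h | h | h | h | h <;> linarith
    have ha : 0 ≤ (x - 4) ^ (1 / 2 : ℝ) := Real.rpow_nonneg h0 _
    have hb : (x - 4) ^ (1 / 2 : ℝ) ≤ 1 :=
      Real.rpow_le_one h0 (by linarith) (by norm_num)
    constructor <;> linarith
  · right; right; right; right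
    rcases hx with h | h | h | h | h <;> constructor <;> linarith
  · right; right; right; left
    have h0 : 0 ≤ x - 8 := by rcases hx with h | h | h | h | h <;> linarith
    have ha : 0 ≤ (x - 8) ^ (1 / 3 : ℝ) := Real.rpow_nonneg h0 _
    have hb : (x - 8) ^ (1 / 3 : ℝ) ≤ 1 :=
      Real.rpow_le_one h0 (by rcases hx with h | h | h | h | h <;> linarith) (by norm_num)
    constructor <;> linarith

/-- The identity map of the five intervals. -/
def f₁ (x : fiveIntervals) : fiveIntervals := x

/-- The self-map `f₂` of the five intervals. -/
noncomputable def f₂ (x : fiveIntervals) : fiveIntervals := ⟨f₂Real x, f₂Real_mem x.2⟩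

/-- The self-map `f₃` of the five intervals. -/
noncomputable def f₃ (x : fiveIntervals) : fiveIntervals := ⟨f₃Real x, f₃Real_mem x.2⟩

/-- The relation `F = Γ(f₁) ∪ Γ(f₂) ∪ Γ(f₃)`, a union of graphs. -/
def F : Set (fiveIntervals × fiveIntervals) :=
  {p | p.2 = f₁ p.1} ∪ {p | p.2 = f₂ p.1} ∪ {p | p.2 = f₃ p.1}

/-! ### Collapsing the sequences of left end-points -/

/-- The left end-points `{0, 2, 4, 6, 8}` of the five intervals. -/
def leftEnds : Set fiveIntervals :=
  {x | (x : ℝ) = 0 ∨ (x : ℝ) = 2 ∨ (x : ℝ) = 4 ∨ (x : ℝ) = 6 ∨ (x : ℝ) = 8}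

/-- The equivalence relation `∼₊` on `X_F^+`. -/
def collapsePlus : Setoid (MahavierPlus F) where
  r x y := x = y ∨ ∀ k, x.1 k ∈ leftEnds ∧ y.1 k ∈ leftEnds
  iseqv :=
    { refl := fun _ => Or.inl rfl
      symm := by
        rintro x y (h | h)
        · exact Or.inl h.symm
        · exact Or.inr fun k => ⟨(h k).2, (h k).1⟩
      trans := by
        rintro x y z (rfl | h) (rfl | h')
        · exact Or.inl rfl
        · exact Or.inr h'
        · exact Or.inr h
        · exact Or.inr fun k => ⟨(h k).1, (h' k).2⟩ }

/-- The equivalence relation `∼` on `X_F`. -/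
def collapse : Setoid (Mahavier F) where
  r x y := x = y ∨ ∀ k, x.1 k ∈ leftEnds ∧ y.1 k ∈ leftEnds
  iseqv :=
    { refl := fun _ => Or.inl rfl
      symm := by
        rintro x y (h | h)
        · exact Or.inl h.symm
        · exact Or.inr fun k => ⟨(h k).2, (h k).1⟩
      trans := by
        rintro x y z (rfl | h) (rfl | h')
        · exact Or.inl rfl
        · exact Or.inr h'
        · exact Or.inr h
        · exact Or.inr fun k => ⟨(h k).1, (h' k).2⟩ }

/-- The quotient space `X_F^+/∼₊`, with the quotient topology. -/
abbrev QuotientPlus : Type := Quotient collapsePlus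

/-- The quotient space `X_F/∼`, with the quotient topology. -/
abbrev QuotientTwoSided : Type := Quotient collapse

/-- The map `(σ_F^+)^⋆`, `[x] ↦ [σ_F^+ x]`. -/
def shiftPlusStar : QuotientPlus → QuotientPlus :=
  Quotient.map (shiftPlus F) (by
    rintro x y (rfl | h)
    · exact Or.inl rfl
    · exact Or.inr fun k => h (k + 1))

/-- The map `σ_F^⋆`, `[x] ↦ [σ_F x]`. -/
def shiftStar : QuotientTwoSided → QuotientTwoSided :=
  Quotient.map (shift F) (by
    rintro x y (rfl | h)
    · exact Or.inl rfl
    · exact Or.inr fun k => h (k + 1))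

end CantorFanChaos

open CantorFanChaos

/-! Write a point of `fiveIntervals` as `(j, t)`: the interval and the height above its left end.
Each branch of `F` then permutes the intervals and raises `t` to a power depending only on the two
intervals involved. Linked intervals form the path 0-1-2-3-4 with a loop at each vertex, and the
logarithms of the exponents are `weight`. Hence an orbit is the same as a walk on this path together
with a height at time 0 (`orbitCoords_bijective`). The walks form a Cantor set, by Brouwer's
characterization, and height 0 never changes, so the quotient collapses the bottom of Cantor set ×
`I`: a Cantor fan.

For the dynamics, the loops let orbits wait, and round trips on the path realize every total weight
in the group generated by `log 2` and `log 3` (`connects_of_mem`). This group is dense because `log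
2 / log 3` is irrational. So any orbit block can be joined to a slight perturbation of any other, in
every large number of steps, which gives mixing; joining a block to its own start gives periodic
points. Both properties are proved for the two-sided shift and pass to its factors. -/

namespace CantorFanChaos

open Set Topology TopologicalSpace

/-! ### Brouwer's characterization of the Cantor set. -/

section CantorCharacterization

variable {X : Type*}

/-- In a perfect, totally disconnected compact space, a nonempty clopen set can be split into two
nonempty clopen pieces, and by a prescribed clopen set if that is possible. -/
theorem exists_isClopen_splitting [TopologicalSpace X] [CompactSpace X] [T2Space X] [TotallyDisconnectedSpace X]
    [PerfectSpace X] {B U : Set X} (hB : IsClopen B) (hU : IsOpen U) (hne : U.Nonempty) :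
    ∃ S : Set X, IsClopen S ∧ (U ∩ S).Nonempty ∧ (U \ S).Nonempty ∧
      (U ⊆ B ∨ Disjoint U B ∨ S = B) := by
  by_cases h : (U ∩ B).Nonempty ∧ (U \ B).Nonempty
  · exact ⟨B, hB, h.1, h.2, Or.inr (Or.inr rfl)⟩
  · obtain ⟨x, hx⟩ := hne
    have hacc := (accPt_iff_nhds).1 (hU.preperfect x hx) U (hU.mem_nhds hx)
    obtain ⟨y, ⟨hyU, -⟩, hyx⟩ := hacc
    obtain ⟨S, hS, hyS, hxS⟩ := exists_isClopen_of_totally_separated hyx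
    refine ⟨S, hS, ⟨y, hyU, hyS⟩, ⟨x, hx, hxS⟩, ?_⟩
    rw [not_and_or, not_nonempty_iff_eq_empty, not_nonempty_iff_eq_empty] at h
    rcases h with h | h
    · exact Or.inr (Or.inl (disjoint_iff_inter_eq_empty.2 h))
    · exact Or.inl (sdiff_eq_empty.1 h)

/-- The cells of a binary scheme: at stage `n` the cell `U` is cut by the set `S n U`. -/
def schemeCell (S : ℕ → Set X → Set X) (b : ℕ → Bool) : ℕ → Set X
  | 0 => univ
  | n + 1 => if b n then schemeCell S b n ∩ S n (schemeCell S b n)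
      else schemeCell S b n \ S n (schemeCell S b n)

theorem schemeCell_congr (S : ℕ → Set X → Set X) {b b' : ℕ → Bool} {n : ℕ}
    (h : ∀ i < n, b i = b' i) : schemeCell S b n = schemeCell S b' n := by
  induction n with
  | zero => rfl
  | succ n ih =>
    simp only [schemeCell, ih fun i hi => h i (by omega), h n (by omega)]

theorem schemeCell_antitone (S : ℕ → Set X → Set X) (b : ℕ → Bool) :
    Antitone (schemeCell S b) := by
  refine antitone_nat_of_succ_le fun n => ?_
  simp only [schemeCell]
  split_ifs
  · exact inter_subset_left
  · exact sdiff_subset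

/-- The code of a point with respect to a binary scheme. -/
theorem exists_forall_mem_schemeCell (S : ℕ → Set X → Set X) (x : X) :
    ∃ b : ℕ → Bool, ∀ n, x ∈ schemeCell S b n := by
  classical
  -- The cells around `x` are built first, since the bit at stage `n` depends on the cell already
  -- reached.
  let c : ℕ → Set X := fun n => Nat.rec univ
    (fun n U => if x ∈ S n U then U ∩ S n U else U \ S n U) n
  have hc : ∀ n, c (n + 1) = if x ∈ S n (c n) then c n ∩ S n (c n) else c n \ S n (c n) :=
    fun n => rfl
  refine ⟨fun n => decide (x ∈ S n (c n)), fun n => ?_⟩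
  suffices h : schemeCell S (fun n => decide (x ∈ S n (c n))) n = c n ∧ x ∈ c n by
    rw [h.1]; exact h.2
  induction n with
  | zero => exact ⟨rfl, mem_univ x⟩
  | succ n ih =>
    obtain ⟨h1, h2⟩ := ih
    rw [hc, schemeCell, h1]
    by_cases h : x ∈ S n (c n) <;> simp [h, h2]

/-- At the first index where two codes differ, the corresponding cells are disjoint. -/
theorem eq_of_mem_schemeCell (S : ℕ → Set X → Set X) {x : X} {b b' : ℕ → Bool}
    (h : ∀ n, x ∈ schemeCell S b n) (h' : ∀ n, x ∈ schemeCell S b' n) : b = b' := by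
  funext n
  induction n using Nat.strong_induction_on with
  | _ n ih =>
    have h1 := h (n + 1)
    have h2 := h' (n + 1)
    rw [schemeCell, schemeCell_congr S ih] at h1
    rw [schemeCell] at h2
    cases hb : b n <;> cases hb' : b' n <;> simp_all

/-- **Brouwer's characterization of the Cantor set.** -/
theorem nonempty_homeomorph_nat_to_bool [TopologicalSpace X] [CompactSpace X] [T2Space X]
    [SecondCountableTopology X] [TotallyDisconnectedSpace X] [PerfectSpace X] [Nonempty X] :
    Nonempty ((ℕ → Bool) ≃ₜ X) := by
  -- Stage `n` is made to decide the `n`-th clopen set, so that in the limit a cell sequence shrinks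
  -- to one point.
  have : Countable (Clopens X) := Clopens.countable_iff_secondCountable.2 inferInstance
  obtain ⟨B, hB⟩ := exists_surjective_nat (Clopens X)
  have key : ∀ (n : ℕ) (U : Set X), ∃ S : Set X, IsOpen U → U.Nonempty →
      IsClopen S ∧ (U ∩ S).Nonempty ∧ (U \ S).Nonempty ∧
      (U ⊆ B n ∨ Disjoint U (B n : Set X) ∨ S = B n) := by
    intro n U
    by_cases h : IsOpen U ∧ U.Nonempty
    · obtain ⟨S, hS⟩ := exists_isClopen_splitting (B n).isClopen h.1 h.2
      exact ⟨S, fun _ _ => hS⟩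
    · exact ⟨∅, fun h1 h2 => absurd ⟨h1, h2⟩ h⟩
  choose S hS using key
  have hcell : ∀ b n, IsClopen (schemeCell S b n) ∧ (schemeCell S b n).Nonempty := by
    intro b n
    induction n with
    | zero => exact ⟨isClopen_univ, univ_nonempty⟩
    | succ n ih =>
      obtain ⟨h1, h2, h3, -⟩ := hS n _ ih.1.isOpen ih.2
      simp only [schemeCell]
      split_ifs
      · exact ⟨ih.1.inter h1, h2⟩
      · exact ⟨ih.1.diff h1, h3⟩
  have hdecide : ∀ b n, schemeCell S b (n + 1) ⊆ B n ∨
      Disjoint (schemeCell S b (n + 1)) (B n : Set X) := by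
    intro b n
    obtain ⟨-, -, -, h⟩ := hS n _ (hcell b n).1.isOpen (hcell b n).2
    rcases h with h | h | h
    · exact Or.inl ((schemeCell_antitone S b n.le_succ).trans h)
    · exact Or.inr (h.mono_left (schemeCell_antitone S b n.le_succ))
    · simp only [schemeCell, h]
      split_ifs
      · exact Or.inl inter_subset_right
      · exact Or.inr disjoint_sdiff_left
  have hne : ∀ b, ∃ x, ∀ n, x ∈ schemeCell S b n := by
    intro b
    obtain ⟨x, hx⟩ := IsCompact.nonempty_iInter_of_sequence_nonempty_isCompact_isClosed
      (schemeCell S b) (fun n => schemeCell_antitone S b n.le_succ) (fun n => (hcell b n).2)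
      isCompact_univ (fun n => (hcell b n).1.isClosed)
    exact ⟨x, mem_iInter.1 hx⟩
  choose g hg using hne
  have hcont : Continuous g := by
    refine isTopologicalBasis_isClopen.continuous_iff.2 fun V hV => ?_
    obtain ⟨n, hn⟩ := hB ⟨V, hV⟩
    have hn' : (B n : Set X) = V := by rw [hn]; rfl
    refine isOpen_iff_mem_nhds.2 fun b hb => ?_
    have hsub : schemeCell S b (n + 1) ⊆ V := by
      rcases hdecide b n with h | h
      · rwa [hn'] at h
      · exact absurd (hn' ▸ hb) (disjoint_left.1 h (hg b (n + 1)))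
    have hnear : ∀ᶠ b' in 𝓝 b, ∀ i ∈ Finset.range (n + 1), b i = b' i := by
      rw [Filter.eventually_all_finset]
      intro i _
      have := (continuous_apply i).continuousAt (x := b)
        |>.preimage_mem_nhds ((isOpen_discrete {b i}).mem_nhds rfl)
      filter_upwards [this] with b' hb'
      exact (mem_singleton_iff.1 hb').symm
    filter_upwards [hnear] with b' hb'
    refine hsub ?_
    rw [schemeCell_congr S fun i hi => hb' i (Finset.mem_range.2 hi)]
    exact hg b' (n + 1)
  have hinj : Function.Injective g := fun b b' h =>
    eq_of_mem_schemeCell S (hg b) (h ▸ hg b')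
  have hsurj : Function.Surjective g := by
    intro x
    obtain ⟨b, hb⟩ := exists_forall_mem_schemeCell S x
    refine ⟨b, ?_⟩
    -- `g b` and `x` share all cells, so no clopen set can separate them.
    by_contra hne
    obtain ⟨V, hV, h1, h2⟩ := exists_isClopen_of_totally_separated hne
    obtain ⟨n, hn⟩ := hB ⟨V, hV⟩
    have hn' : (B n : Set X) = V := by rw [hn]; rfl
    rcases hdecide b n with h | h <;> rw [hn'] at h
    · exact h2 (h (hb (n + 1)))
    · exact disjoint_left.1 h (hg b (n + 1)) h1
  exact ⟨(isHomeomorph_iff_continuous_bijective.2 ⟨hcont, hinj, hsurj⟩).homeomorph⟩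

theorem nonempty_homeomorph_cantorSet [TopologicalSpace X] [CompactSpace X] [T2Space X]
    [SecondCountableTopology X] [TotallyDisconnectedSpace X] [PerfectSpace X] [Nonempty X] :
    Nonempty (X ≃ₜ cantorSet) :=
  nonempty_homeomorph_nat_to_bool.map fun e => e.symm.trans cantorSetHomeomorphNatToBool.symm

end CantorCharacterization

end CantorFanChaos

namespace CantorFanChaos

open Set Topology unitInterval

/-! ### Power maps of the unit interval as a flow. -/

section PowerFlow

/-- The power map `t ↦ t ^ exp a` of the unit interval; an additive action of `ℝ`. -/
noncomputable def flow (a : ℝ) (t : I) : I :=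
  ⟨(t : ℝ) ^ Real.exp a, Real.rpow_nonneg t.2.1 _,
    Real.rpow_le_one t.2.1 t.2.2 (Real.exp_pos a).le⟩

@[simp] theorem flow_zero (t : I) : flow 0 t = t := by
  apply Subtype.ext; simp [flow]

@[simp] theorem flow_flow (a b : ℝ) (t : I) : flow b (flow a t) = flow (a + b) t := by
  apply Subtype.ext
  simp only [flow]
  rw [← Real.rpow_mul t.2.1, Real.exp_add]

theorem flow_injective (a : ℝ) : Function.Injective (flow a) := fun s t h => by
  simpa using congrArg (flow (-a)) h

@[simp] theorem flow_apply_zero (a : ℝ) : flow a 0 = 0 := by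
  apply Subtype.ext; simp [flow, (Real.exp_pos a).ne']

@[simp] theorem flow_apply_one (a : ℝ) : flow a 1 = 1 := by
  apply Subtype.ext; simp [flow]

@[simp] theorem flow_eq_zero_iff {a : ℝ} {t : I} : flow a t = 0 ↔ t = 0 := by
  rw [← flow_apply_zero a, (flow_injective a).eq_iff, flow_apply_zero]

theorem continuous_flow : Continuous fun p : ℝ × I => flow p.1 p.2 := by
  refine Continuous.subtype_mk ?_ _
  -- At base 0 continuity relies on the exponent being positive.
  exact (continuous_subtype_val.comp continuous_snd).rpow
    (Real.continuous_exp.comp continuous_fst) fun p => Or.inr (Real.exp_pos _)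

/-- The power flow is transitive on the interior of the unit interval. -/
theorem exists_flow_eq {s t : I} (hs0 : s ≠ 0) (hs1 : s ≠ 1) (ht0 : t ≠ 0) (ht1 : t ≠ 1) :
    ∃ a, flow a s = t := by
  have pos : ∀ {u : I}, u ≠ 0 → (0 : ℝ) < u := fun h => unitInterval.pos_iff_ne_zero.2 h
  have lt : ∀ {u : I}, u ≠ 1 → (u : ℝ) < 1 := fun h => unitInterval.lt_one_iff_ne_one.2 h
  have hls := Real.log_neg (pos hs0) (lt hs1)
  have hlt := Real.log_neg (pos ht0) (lt ht1)
  -- Solves `exp a * log s = log t`; the quotient is positive because both logarithms are negative.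
  refine ⟨Real.log (Real.log t / Real.log s), Subtype.ext ?_⟩
  change (s : ℝ) ^ Real.exp _ = t
  rw [Real.exp_log (div_pos_of_neg_of_neg hlt hls), Real.rpow_def_of_pos (pos hs0),
    mul_div_cancel₀ _ hls.ne, Real.exp_log (pos ht0)]

end PowerFlow

/-! ### The relation in interval-height coordinates. -/

section Coordinates

/-- The point at height `t` of the `j`-th interval. -/
def point (p : Fin 5 × I) : fiveIntervals :=
  ⟨2 * (p.1 : ℕ) + p.2, by
    obtain ⟨j, t, h0, h1⟩ := p
    rw [mem_fiveIntervals]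
    fin_cases j
    · left; norm_num; exact ⟨h0, h1⟩
    · right; left; norm_num; exact ⟨h0, by linarith⟩
    · right; right; left; norm_num; exact ⟨h0, by linarith⟩
    · right; right; right; left; norm_num; exact ⟨h0, by linarith⟩
    · right; right; right; right; norm_num; exact ⟨h0, by linarith⟩⟩

theorem coe_point (j : Fin 5) (t : I) : (point (j, t) : ℝ) = 2 * (j : ℕ) + t := rfl

theorem continuous_point : Continuous point := by
  refine Continuous.subtype_mk ?_ _
  have : Continuous fun j : Fin 5 => (2 * ((j : ℕ) : ℝ)) := continuous_of_discreteTopology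
  exact (this.comp continuous_fst).add (continuous_subtype_val.comp continuous_snd)

theorem point_bijective : Function.Bijective point := by
  constructor
  · rintro ⟨j, s⟩ ⟨k, t⟩ h
    have h' : (2 * (j : ℕ) + s : ℝ) = 2 * (k : ℕ) + t := congrArg Subtype.val h
    have hs := s.2
    have ht := t.2
    have h1 : ((j : ℕ) : ℝ) < (k : ℕ) + 1 := by linarith [hs.1, ht.2]
    have h2 : ((k : ℕ) : ℝ) < (j : ℕ) + 1 := by linarith [hs.2, ht.1]
    norm_cast at h1 h2
    have hjk : j = k := by omega
    subst hjk
    exact Prod.ext rfl (Subtype.ext (by linarith))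
  · rintro ⟨x, hx⟩
    rcases mem_fiveIntervals.1 hx with h | h | h | h | h
    · exact ⟨(0, ⟨x, h⟩), Subtype.ext (by simp [point])⟩
    · exact ⟨(1, ⟨x - 2, by constructor <;> linarith⟩), Subtype.ext (by simp [point])⟩
    · exact ⟨(2, ⟨x - 4, by constructor <;> linarith⟩),
        Subtype.ext (by simp only [point]; push_cast [Fin.val_two]; ring)⟩
    · exact ⟨(3, ⟨x - 6, by constructor <;> linarith⟩),
        Subtype.ext (by simp only [point, show ((3 : Fin 5) : ℕ) = 3 from rfl]; push_cast; ring)⟩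
    · exact ⟨(4, ⟨x - 8, by constructor <;> linarith⟩),
        Subtype.ext (by simp only [point, show ((4 : Fin 5) : ℕ) = 4 from rfl]; push_cast; ring)⟩

/-- The five intervals, in coordinates. -/
noncomputable def pointHomeo : Fin 5 × I ≃ₜ fiveIntervals :=
  (isHomeomorph_iff_continuous_bijective.2 ⟨continuous_point, point_bijective⟩).homeomorph

instance : CompactSpace fiveIntervals := pointHomeo.compactSpace

theorem point_injective : Function.Injective point := point_bijective.1

theorem point_mem_leftEnds {p : Fin 5 × I} : point p ∈ leftEnds ↔ p.2 = 0 := by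
  obtain ⟨j, t⟩ := p
  constructor
  · intro h
    have key : ∀ k : Fin 5, (point (j, t) : ℝ) = 2 * (k : ℕ) → t = 0 := by
      intro k hk
      have : point (j, t) = point (k, 0) := Subtype.ext (by rw [hk, coe_point]; simp)
      exact congrArg Prod.snd (point_injective this)
    rcases h with h | h | h | h | h
    · exact key 0 (by rw [h]; simp)
    · exact key 1 (by rw [h]; simp)
    · exact key 2 (by rw [h]; norm_num)
    · exact key 3 (by rw [h, show ((3 : Fin 5) : ℕ) = 3 from rfl]; norm_num)
    · exact key 4 (by rw [h, show ((4 : Fin 5) : ℕ) = 4 from rfl]; norm_num)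
  · intro h
    replace h : t = 0 := h
    subst h
    change (point (j, 0) : ℝ) = 0 ∨ (point (j, 0) : ℝ) = 2 ∨ (point (j, 0) : ℝ) = 4 ∨
      (point (j, 0) : ℝ) = 6 ∨ (point (j, 0) : ℝ) = 8
    rw [coe_point]
    fin_cases j <;> norm_num

/-- The permutation of the five intervals induced by `f₂`. -/
def swap₂ : Equiv.Perm (Fin 5) := Equiv.swap 0 1 * Equiv.swap 2 3

/-- The permutation of the five intervals induced by `f₃`. -/
def swap₃ : Equiv.Perm (Fin 5) := Equiv.swap 1 2 * Equiv.swap 3 4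

/-- The logarithms of the exponents of the branches of the relation. -/
noncomputable def weight (j k : Fin 5) : ℝ :=
  if j = 1 ∧ k = 0 then Real.log 2
  else if j = 2 ∧ k = 1 then -Real.log 2
  else if j = 3 ∧ k = 2 then Real.log 3
  else if j = 4 ∧ k = 3 then -Real.log 3
  else 0

@[simp] theorem weight_self (j : Fin 5) : weight j j = 0 := by
  fin_cases j <;> simp [weight]

theorem weight_0_1 : weight 0 1 = 0 := by simp +decide [weight]

theorem weight_1_0 : weight 1 0 = Real.log 2 := by simp +decide [weight]

theorem weight_1_2 : weight 1 2 = 0 := by simp +decide [weight]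

theorem weight_2_1 : weight 2 1 = -Real.log 2 := by simp +decide [weight]

theorem weight_2_3 : weight 2 3 = 0 := by simp +decide [weight]

theorem weight_3_2 : weight 3 2 = Real.log 3 := by simp +decide [weight]

theorem weight_3_4 : weight 3 4 = 0 := by simp +decide [weight]

theorem weight_4_3 : weight 4 3 = -Real.log 3 := by simp +decide [weight]

theorem coe_flow_log {c : ℝ} (hc : 0 < c) (t : I) : (flow (Real.log c) t : ℝ) = (t : ℝ) ^ c := by
  change (t : ℝ) ^ Real.exp (Real.log c) = _
  rw [Real.exp_log hc]

theorem coe_flow_neg_log {c : ℝ} (hc : 0 < c) (t : I) :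
    (flow (-Real.log c) t : ℝ) = (t : ℝ) ^ (1 / c) := by
  change (t : ℝ) ^ Real.exp (-Real.log c) = _
  rw [Real.exp_neg, Real.exp_log hc, one_div]

theorem fin_five_cases (j : Fin 5) : j = 0 ∨ j = 1 ∨ j = 2 ∨ j = 3 ∨ j = 4 := by
  revert j; decide

theorem f₂_point (j : Fin 5) (t : I) :
    f₂ (point (j, t)) = point (swap₂ j, flow (weight j (swap₂ j)) t) := by
  apply Subtype.ext
  change f₂Real (point (j, t)) = _
  have h0 := t.2.1
  have h1 := t.2.2
  rw [coe_point, coe_point, f₂Real]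
  rcases fin_five_cases j with rfl | rfl | rfl | rfl | rfl
  · rw [show swap₂ 0 = 1 by decide, weight_0_1]
    norm_num [h1, add_comm]
  · rw [show swap₂ 1 = 0 by decide, weight_1_0, if_neg (by norm_num; linarith),
      if_pos (by norm_num; linarith)]
    norm_num [coe_flow_log]
  · rw [show swap₂ 2 = 3 by decide, weight_2_3, if_neg (by norm_num; linarith),
      if_neg (by norm_num; linarith), if_pos (by norm_num; linarith),
      show ((3 : Fin 5) : ℕ) = 3 from rfl]
    norm_num; ring
  · rw [show swap₂ 3 = 2 by decide, weight_3_2, show ((3 : Fin 5) : ℕ) = 3 from rfl,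
      if_neg (by norm_num; linarith), if_neg (by norm_num; linarith),
      if_neg (by norm_num; linarith), if_pos (by norm_num; linarith)]
    norm_num [coe_flow_log]; ring
  · rw [show swap₂ 4 = 4 by decide, show ((4 : Fin 5) : ℕ) = 4 from rfl,
      if_neg (by norm_num; linarith), if_neg (by norm_num; linarith),
      if_neg (by norm_num; linarith), if_neg (by norm_num; linarith)]
    norm_num

theorem f₃_point (j : Fin 5) (t : I) :
    f₃ (point (j, t)) = point (swap₃ j, flow (weight j (swap₃ j)) t) := by
  apply Subtype.ext
  change f₃Real (point (j, t)) = _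
  have h0 := t.2.1
  have h1 := t.2.2
  rw [coe_point, coe_point, f₃Real]
  rcases fin_five_cases j with rfl | rfl | rfl | rfl | rfl
  · rw [show swap₃ 0 = 0 by decide]
    norm_num [h1]
  · rw [show swap₃ 1 = 2 by decide, weight_1_2, if_neg (by norm_num; linarith),
      if_pos (by norm_num; linarith)]
    norm_num; ring
  · rw [show swap₃ 2 = 1 by decide, weight_2_1, if_neg (by norm_num; linarith),
      if_neg (by norm_num; linarith), if_pos (by norm_num; linarith)]
    norm_num [coe_flow_neg_log, -one_div]; ring
  · rw [show swap₃ 3 = 4 by decide, weight_3_4, show ((3 : Fin 5) : ℕ) = 3 from rfl,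
      show ((4 : Fin 5) : ℕ) = 4 from rfl,
      if_neg (by norm_num; linarith), if_neg (by norm_num; linarith),
      if_neg (by norm_num; linarith), if_pos (by norm_num; linarith)]
    norm_num; ring
  · rw [show swap₃ 4 = 3 by decide, weight_4_3, show ((3 : Fin 5) : ℕ) = 3 from rfl,
      show ((4 : Fin 5) : ℕ) = 4 from rfl,
      if_neg (by norm_num; linarith), if_neg (by norm_num; linarith),
      if_neg (by norm_num; linarith), if_neg (by norm_num; linarith)]
    norm_num [coe_flow_neg_log, -one_div]; ring

/-- A map that permutes the intervals and acts by power maps on each is a homeomorphism. -/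
theorem isHomeomorph_of_point {g : fiveIntervals → fiveIntervals} (π : Equiv.Perm (Fin 5))
    (a : Fin 5 → ℝ) (hg : ∀ j t, g (point (j, t)) = point (π j, flow (a j) t)) :
    IsHomeomorph g := by
  have hG : g = pointHomeo ∘ (fun p : Fin 5 × I => (π p.1, flow (a p.1) p.2)) ∘
      pointHomeo.symm := by
    funext x
    obtain ⟨⟨j, t⟩, rfl⟩ := pointHomeo.surjective x
    have h : pointHomeo.symm (pointHomeo (j, t)) = (j, t) := pointHomeo.symm_apply_apply _
    simp only [Function.comp_apply, h]
    exact hg j t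
  rw [hG]
  refine pointHomeo.isHomeomorph.comp (IsHomeomorph.comp ?_ pointHomeo.symm.isHomeomorph)
  refine isHomeomorph_iff_continuous_bijective.2 ⟨?_, ?_, ?_⟩
  · have h1 : Continuous π := continuous_of_discreteTopology
    have h2 : Continuous a := continuous_of_discreteTopology
    exact (h1.comp continuous_fst).prodMk
      (continuous_flow.comp ((h2.comp continuous_fst).prodMk continuous_snd))
  · rintro ⟨j, s⟩ ⟨k, t⟩ h
    obtain ⟨h1, h2⟩ := Prod.ext_iff.1 h
    obtain rfl : j = k := π.injective h1
    exact Prod.ext rfl (flow_injective _ h2)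
  · rintro ⟨k, t⟩
    exact ⟨(π.symm k, flow (-a (π.symm k)) t), by simp⟩

theorem isHomeomorph_f₁ : IsHomeomorph f₁ := IsHomeomorph.id

theorem isHomeomorph_f₂ : IsHomeomorph f₂ := isHomeomorph_of_point swap₂ _ f₂_point

theorem isHomeomorph_f₃ : IsHomeomorph f₃ := isHomeomorph_of_point swap₃ _ f₃_point

/-- Two intervals are linked if some branch of the relation leads from one to the other. -/
def Linked (j k : Fin 5) : Prop := k = j ∨ k = swap₂ j ∨ k = swap₃ j

instance (j k : Fin 5) : Decidable (Linked j k) :=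
  inferInstanceAs (Decidable (_ ∨ _))

theorem Linked.refl (j : Fin 5) : Linked j j := Or.inl rfl

theorem exists_linked_ne (j : Fin 5) : ∃ k, Linked j k ∧ k ≠ j := by
  revert j; decide

/-- Where two branches lead from one interval to the same interval, both are the identity there. So
the pair of intervals alone determines the exponent, and three graphs reduce to one formula. -/
theorem point_mem_F {j k : Fin 5} {s t : I} :
    (point (j, s), point (k, t)) ∈ F ↔ Linked j k ∧ t = flow (weight j k) s := by
  simp only [F, f₁, mem_union, mem_ofPred_eq, f₂_point, f₃_point, point_injective.eq_iff,
    Prod.mk.injEq, Linked]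
  constructor
  · rintro ((⟨rfl, rfl⟩ | ⟨rfl, rfl⟩) | ⟨rfl, rfl⟩)
    · simp
    · exact ⟨Or.inr (Or.inl rfl), rfl⟩
    · exact ⟨Or.inr (Or.inr rfl), rfl⟩
  · rintro ⟨rfl | rfl | rfl, rfl⟩
    · simp
    · exact Or.inl (Or.inr ⟨rfl, rfl⟩)
    · exact Or.inr ⟨rfl, rfl⟩

theorem mem_F_self (x : fiveIntervals) : (x, x) ∈ F := Or.inl (Or.inl rfl)

theorem isClosed_F : IsClosed F :=
  ((isClosed_eq continuous_snd (isHomeomorph_f₁.continuous.comp continuous_fst)).union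
    (isClosed_eq continuous_snd (isHomeomorph_f₂.continuous.comp continuous_fst))).union
    (isClosed_eq continuous_snd (isHomeomorph_f₃.continuous.comp continuous_fst))

end Coordinates

end CantorFanChaos

namespace CantorFanChaos

open Set Topology unitInterval

/-! ### Reading off interval and height. -/

section Heights

/-- The index of the interval containing a point. -/
noncomputable def idx (x : fiveIntervals) : Fin 5 := (pointHomeo.symm x).1

/-- The height of a point above the left end of its interval. -/
noncomputable def height (x : fiveIntervals) : I := (pointHomeo.symm x).2

theorem point_idx_height (x : fiveIntervals) : point (idx x, height x) = x :=
  pointHomeo.apply_symm_apply x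

theorem idx_height_point (p : Fin 5 × I) : (idx (point p), height (point p)) = p :=
  pointHomeo.symm_apply_apply p

@[simp] theorem idx_point (p : Fin 5 × I) : idx (point p) = p.1 :=
  congrArg Prod.fst (idx_height_point p)

@[simp] theorem height_point (p : Fin 5 × I) : height (point p) = p.2 :=
  congrArg Prod.snd (idx_height_point p)

theorem continuous_idx : Continuous idx := continuous_fst.comp pointHomeo.symm.continuous

theorem continuous_height : Continuous height := continuous_snd.comp pointHomeo.symm.continuous

theorem mem_F_iff {x y : fiveIntervals} : (x, y) ∈ F ↔
    Linked (idx x) (idx y) ∧ height y = flow (weight (idx x) (idx y)) (height x) := by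
  conv_lhs => rw [← point_idx_height x, ← point_idx_height y]
  exact point_mem_F

theorem mem_leftEnds_iff {x : fiveIntervals} : x ∈ leftEnds ↔ height x = 0 := by
  conv_lhs => rw [← point_idx_height x]
  exact point_mem_leftEnds

end Heights

/-! ### Orbits as walks with an initial height, for `ℕ` and `ℤ` at once. -/

section Orbits

/-- The index sets `ℕ` and `ℤ` of one-sided and two-sided sequences. -/
class IsStepIndex (ι : Type) [LinearOrder ι] [Zero ι] [One ι] [Add ι] : Prop where
  lt_add_one (i : ι) : i < i + 1
  le_of_lt_add_one {i j : ι} : i < j + 1 → i ≤ j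
  exists_sum (d : ι → ℝ) : ∃ e : ι → ℝ, e 0 = 0 ∧ ∀ i, e (i + 1) = e i + d i
  eq_zero_of_step (s : ι → I) : (∀ i, s (i + 1) = s i) → ∀ i, s i = s 0

instance : IsStepIndex ℕ where
  lt_add_one := Nat.lt_succ_self
  le_of_lt_add_one := Nat.le_of_lt_succ
  exists_sum d := ⟨fun n => ∑ i ∈ Finset.range n, d i, by simp, fun n => Finset.sum_range_succ _ _⟩
  eq_zero_of_step s h i := by
    induction i with
    | zero => rfl
    | succ n ih => rw [h, ih]

instance : IsStepIndex ℤ where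
  lt_add_one i := by omega
  le_of_lt_add_one h := by omega
  exists_sum d := by
    -- `toNat` empties one of the sums: for negative `n` the value is minus the sum of `d` over `n,
    -- …, -1`.
    refine ⟨fun n => ∑ i ∈ Finset.range n.toNat, d i -
      ∑ i ∈ Finset.range (-n).toNat, d (-(i : ℤ) - 1), by simp, fun n => ?_⟩
    rcases le_or_gt 0 n with h | h
    · lift n to ℕ using h
      have h1 : ((n : ℤ) + 1).toNat = n + 1 := by omega
      have h2 : (-((n : ℤ) + 1)).toNat = 0 := by omega
      have h3 : (-(n : ℤ)).toNat = 0 := by omega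
      simp only [h1, h2, h3, Finset.sum_range_succ]
      simp
    · obtain ⟨k, rfl⟩ : ∃ k : ℕ, n = -(k : ℤ) - 1 := ⟨(-n - 1).toNat, by omega⟩
      have h1 : (-(k : ℤ) - 1 + 1).toNat = 0 := by omega
      have h2 : (-(-(k : ℤ) - 1 + 1)).toNat = k := by omega
      have h3 : (-(k : ℤ) - 1).toNat = 0 := by omega
      have h4 : (-(-(k : ℤ) - 1)).toNat = k + 1 := by omega
      simp only [h1, h2, h3, h4, Finset.sum_range_succ]
      simp
  eq_zero_of_step s h i := by
    induction i with
    | zero => rfl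
    | succ n ih => rw [h, ih]
    | pred n ih => rw [← ih, ← h, sub_add_cancel]

variable (ι : Type) [Add ι] [One ι]

/-- Walks through the linked intervals. -/
abbrev Walk : Type := {w : ι → Fin 5 // ∀ i, Linked (w i) (w (i + 1))}

/-- Sequences of points that follow the relation. -/
abbrev Orbit : Type := {x : ι → fiveIntervals // ∀ i, (x i, x (i + 1)) ∈ F}

instance : CompactSpace (Walk ι) := by
  refine isCompact_iff_compactSpace.1 (IsClosed.isCompact ?_)
  change IsClosed {w : ι → Fin 5 | ∀ i, Linked (w i) (w (i + 1))}
  rw [ofPred_forall]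
  refine isClosed_iInter fun i => ?_
  exact (isClosed_discrete {p : Fin 5 × Fin 5 | Linked p.1 p.2}).preimage
    (f := fun w : ι → Fin 5 => (w i, w (i + 1)))
    ((continuous_apply i).prodMk (continuous_apply (i + 1)))

instance : CompactSpace (Orbit ι) := by
  refine isCompact_iff_compactSpace.1 (IsClosed.isCompact ?_)
  change IsClosed {x : ι → fiveIntervals | ∀ i, (x i, x (i + 1)) ∈ F}
  rw [ofPred_forall]
  exact isClosed_iInter fun i =>
    isClosed_F.preimage ((continuous_apply i).prodMk (continuous_apply (i + 1)))

instance : Nonempty (Walk ι) := ⟨⟨fun _ => 0, fun _ => Linked.refl 0⟩⟩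

variable {ι} [Zero ι]

/-- The walk and the initial height of an orbit. -/
noncomputable def orbitCoords (x : Orbit ι) : Walk ι × I :=
  (⟨fun i => idx (x.1 i), fun i => (mem_F_iff.1 (x.2 i)).1⟩, height (x.1 0))

theorem continuous_orbitCoords : Continuous (orbitCoords (ι := ι)) := by
  refine Continuous.prodMk (Continuous.subtype_mk (continuous_pi fun i => ?_) _) ?_
  · exact continuous_idx.comp ((continuous_apply i).comp continuous_subtype_val)
  · exact continuous_height.comp ((continuous_apply 0).comp continuous_subtype_val)

variable [LinearOrder ι] [IsStepIndex ι]

/-- Follow a walk up to time `N`, then stay at `k`. -/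
def Walk.truncate (w : Walk ι) (N : ι) (k : Fin 5) (h : Linked (w.1 N) k) : Walk ι :=
  ⟨fun i => if i ≤ N then w.1 i else k, fun i => by
    have hi := IsStepIndex.lt_add_one i
    rcases lt_trichotomy i N with h1 | rfl | h1
    · have h2 : i + 1 ≤ N := by
        by_contra h3
        exact absurd (IsStepIndex.le_of_lt_add_one (not_le.1 h3)) (not_le.2 h1)
      simp only [h1.le, h2, if_true]
      exact w.2 i
    · simpa [not_le.2 hi] using h
    · simp only [not_le.2 h1, not_le.2 (h1.trans hi), if_false]
      exact Linked.refl k⟩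

/-- A neighbourhood constrains only finitely many coordinates. Truncating beyond them, and then
either staying or moving to a neighbour, gives two continuations; one differs from `w` at `N + 1`.
-/
instance : PerfectSpace (Walk ι) := by
  refine perfectSpace_iff_forall_not_isolated.2 fun w => ?_
  refine mem_closure_iff_nhdsWithin_neBot.1 (mem_closure_iff.2 fun U hU hw => ?_)
  obtain ⟨V, hV, rfl⟩ := isOpen_induced_iff.1 hU
  obtain ⟨J, u, hu, hJ⟩ := isOpen_pi_iff.1 hV w.1 hw
  have : Nonempty ι := ⟨0⟩
  obtain ⟨N, hN⟩ := J.exists_le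
  have hmem : ∀ k h, w.truncate N k h ∈ (Subtype.val ⁻¹' V : Set (Walk ι)) := fun k h =>
    hJ fun i hi => by
      have := (hu i hi).2
      simpa only [Walk.truncate, hN i hi, if_true] using this
  obtain ⟨k, hk, hne⟩ := exists_linked_ne (w.1 N)
  by_cases h : w.1 (N + 1) = k
  · refine ⟨_, hmem (w.1 N) (Linked.refl _), fun heq => hne ?_⟩
    have := congrFun (congrArg Subtype.val heq) (N + 1)
    simpa [Walk.truncate, IsStepIndex.lt_add_one, h] using this.symm
  · refine ⟨_, hmem k hk, fun heq => h ?_⟩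
    have := congrFun (congrArg Subtype.val heq) (N + 1)
    simpa [Walk.truncate, IsStepIndex.lt_add_one] using this.symm

theorem nonempty_walk_homeomorph_cantorSet [Countable ι] : Nonempty (Walk ι ≃ₜ cantorSet) := by
  have : SecondCountableTopology (Walk ι) := IsInducing.subtypeVal.secondCountableTopology
  exact nonempty_homeomorph_cantorSet

/-- The height along an orbit evolves by the cumulated weights of its walk. -/
theorem height_eq_flow_sum (x : Orbit ι) {e : ι → ℝ} (h0 : e 0 = 0)
    (he : ∀ i, e (i + 1) = e i + weight (idx (x.1 i)) (idx (x.1 (i + 1)))) (i : ι) :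
    height (x.1 i) = flow (e i) (height (x.1 0)) := by
  -- Undoing the accumulated exponent leaves a quantity constant along the orbit.
  have h := IsStepIndex.eq_zero_of_step (fun i => flow (-e i) (height (x.1 i))) (fun i => by
    simp only [(mem_F_iff.1 (x.2 i)).2, flow_flow, he]
    congr 1; ring) i
  simp only [h0, neg_zero, flow_zero] at h
  rw [← h]; simp

/-- The exponents depend only on the walk and power maps are invertible, so the height at time 0
fixes all heights, past ones included. -/
theorem orbitCoords_bijective : Function.Bijective (orbitCoords (ι := ι)) := by
  constructor
  · intro x y hxy
    obtain ⟨h1, h2⟩ := Prod.ext_iff.1 hxy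
    have hidx : ∀ i, idx (x.1 i) = idx (y.1 i) := fun i => congrFun (congrArg Subtype.val h1) i
    obtain ⟨e, he0, he⟩ := IsStepIndex.exists_sum
      fun i => weight (idx (x.1 i)) (idx (x.1 (i + 1)))
    refine Subtype.ext (funext fun i => ?_)
    rw [← point_idx_height (x.1 i), ← point_idx_height (y.1 i), hidx,
      height_eq_flow_sum x he0 he, height_eq_flow_sum y he0 (by simpa only [hidx] using he)]
    exact congrArg (fun t => point (_, flow _ t)) h2
  · rintro ⟨w, t⟩
    obtain ⟨e, he0, he⟩ := IsStepIndex.exists_sum fun i => weight (w.1 i) (w.1 (i + 1))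
    refine ⟨⟨fun i => point (w.1 i, flow (e i) t), fun i => point_mem_F.2 ⟨w.2 i, ?_⟩⟩, ?_⟩
    · rw [he, flow_flow]
    · refine Prod.ext (Subtype.ext (funext fun i => ?_)) ?_
      · simp [orbitCoords]
      · simp [orbitCoords, he0]

/-- Power maps preserve both zero and non-zero heights, so the collapsed sequences are exactly those
starting at height 0. -/
theorem height_eq_zero_iff (x : Orbit ι) (i : ι) : height (x.1 i) = 0 ↔ height (x.1 0) = 0 := by
  obtain ⟨e, he0, he⟩ := IsStepIndex.exists_sum
    fun i => weight (idx (x.1 i)) (idx (x.1 (i + 1)))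
  rw [height_eq_flow_sum x he0 he, flow_eq_zero_iff]

theorem forall_mem_leftEnds_iff {x y : Orbit ι} :
    (∀ i, x.1 i ∈ leftEnds ∧ y.1 i ∈ leftEnds) ↔
      (orbitCoords x).2 = 0 ∧ (orbitCoords y).2 = 0 := by
  simp only [mem_leftEnds_iff, height_eq_zero_iff _ (_ : ι), orbitCoords]
  exact ⟨fun h => h 0, fun h _ => h⟩

end Orbits

/-! ### The quotients are Cantor fans. -/

section Fan

theorem smul_mem_standardCantorFan {c : ℝ} (hc : c ∈ cantorSet) (t : I) :
    ((t : ℝ) * c, (t : ℝ)) ∈ standardCantorFan := by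
  refine mem_iUnion₂.2 ⟨c, hc, 1 - t, t, by linarith [t.2.2], t.2.1, by ring, ?_⟩
  simp

/-- A compact product of a Cantor set with the unit interval becomes a Cantor fan when its
bottom is collapsed. -/
theorem nonempty_quotient_homeomorph_fan {Z K : Type*} [TopologicalSpace Z] [CompactSpace Z]
    [TopologicalSpace K] (s : Setoid Z) (ψ : K ≃ₜ cantorSet) {p : Z → K × I} (hp : Continuous p)
    (hb : Function.Bijective p)
    (hs : ∀ x y, s x y ↔ x = y ∨ (p x).2 = 0 ∧ (p y).2 = 0) :
    Nonempty (Quotient s ≃ₜ standardCantorFan) := by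
  let q : Z → standardCantorFan := fun z =>
    ⟨(((p z).2 : ℝ) * (ψ (p z).1 : ℝ), ((p z).2 : ℝ)),
      smul_mem_standardCantorFan (ψ (p z).1).2 _⟩
  have hq : Continuous q := by
    refine Continuous.subtype_mk (Continuous.prodMk (Continuous.mul ?_ ?_) ?_) _
    · exact continuous_subtype_val.comp (continuous_snd.comp hp)
    · exact continuous_subtype_val.comp (ψ.continuous.comp (continuous_fst.comp hp))
    · exact continuous_subtype_val.comp (continuous_snd.comp hp)
  -- The map `(c, t) ↦ (t * c, t)` is injective except that it crushes `t = 0`.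
  have hker : ∀ x y, q x = q y ↔ s x y := by
    intro x y
    rw [hs]
    constructor
    · intro h
      obtain ⟨h1, h2⟩ := Prod.ext_iff.1 (congrArg Subtype.val h)
      have ht : (p x).2 = (p y).2 := Subtype.ext h2
      by_cases h0 : (p x).2 = 0
      · exact Or.inr ⟨h0, ht ▸ h0⟩
      · refine Or.inl (hb.1 (Prod.ext (ψ.injective (Subtype.ext ?_)) ht))
        have h1' : ((p x).2 : ℝ) * ψ (p x).1 = (p y).2 * ψ (p y).1 := h1
        rw [← ht] at h1'
        exact mul_left_cancel₀ (fun h => h0 (Subtype.ext h)) h1'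
    · rintro (rfl | ⟨h1, h2⟩)
      · rfl
      · apply Subtype.ext
        simp [q, h1, h2]
  have hsurj : Function.Surjective q := by
    rintro ⟨v, hv⟩
    obtain ⟨c, hc, a, t, ha, ht, hat, rfl⟩ := mem_iUnion₂.1 hv
    obtain ⟨z, hz⟩ := hb.2 (ψ.symm ⟨c, hc⟩, ⟨t, ht, by linarith⟩)
    refine ⟨z, Subtype.ext ?_⟩
    simp [q, hz]
  exact ⟨(isHomeomorph_iff_continuous_bijective.2
    ⟨hq.quotient_lift fun x y h => (hker x y).2 h,
    fun a b => Quotient.inductionOn₂ a b fun x y h => Quotient.sound ((hker x y).1 h),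
    Quot.surjective_lift _ |>.2 hsurj⟩).homeomorph⟩

theorem nonempty_quotientPlus_homeomorph_fan : Nonempty (QuotientPlus ≃ₜ standardCantorFan) := by
  obtain ⟨ψ⟩ := nonempty_walk_homeomorph_cantorSet (ι := ℕ)
  exact nonempty_quotient_homeomorph_fan (Z := Orbit ℕ) collapsePlus ψ continuous_orbitCoords
    orbitCoords_bijective fun x y => or_congr Iff.rfl forall_mem_leftEnds_iff

theorem nonempty_quotientTwoSided_homeomorph_fan :
    Nonempty (QuotientTwoSided ≃ₜ standardCantorFan) := by
  obtain ⟨ψ⟩ := nonempty_walk_homeomorph_cantorSet (ι := ℤ)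
  exact nonempty_quotient_homeomorph_fan (Z := Orbit ℤ) collapse ψ continuous_orbitCoords
    orbitCoords_bijective fun x y => or_congr Iff.rfl forall_mem_leftEnds_iff

end Fan

end CantorFanChaos

namespace CantorFanChaos

open Set Topology unitInterval

/-! ### Mixing and dense periodic points pass to factors. -/

section Factors

variable {Y Z : Type*} [TopologicalSpace Y] [TopologicalSpace Z] {g : Y → Y} {h : Z → Z}
  {π : Y → Z}

theorem IsMixingMap.of_semiconj (hg : IsMixingMap g) (hc : Continuous π)
    (hs : Function.Surjective π) (hπ : Function.Semiconj π g h) : IsMixingMap h := by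
  intro U V hU hV hU' hV'
  obtain ⟨n₀, hn⟩ := hg (π ⁻¹' U) (π ⁻¹' V) (hU.preimage hc) (hV.preimage hc)
    (hU'.preimage hs) (hV'.preimage hs)
  refine ⟨n₀, fun n h0 h1 => ?_⟩
  obtain ⟨_, ⟨y, hy, rfl⟩, hyV⟩ := hn n h0 h1
  exact ⟨_, mem_image_of_mem _ hy, by rw [← (hπ.iterate_right n).eq]; exact hyV⟩

theorem dense_periodicPts_of_semiconj (hg : Dense (Function.periodicPts g)) (hc : Continuous π)
    (hs : Function.Surjective π) (hπ : Function.Semiconj π g h) :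
    Dense (Function.periodicPts h) := by
  refine (hs.denseRange.dense_image hc hg).mono ?_
  rintro _ ⟨y, ⟨n, hn, hy⟩, rfl⟩
  exact ⟨n, hn, hy.map hπ⟩

theorem IsMixingMap.isTransitiveMap (hg : IsMixingMap g) : IsTransitiveMap g := by
  intro U V hU hV hU' hV'
  obtain ⟨n₀, hn⟩ := hg U V hU hV hU' hV'
  exact ⟨n₀ + 1, hn _ n₀.succ_pos n₀.le_succ⟩

end Factors

/-! ### The dense group of weights. -/

section Weights

/-- The group of logarithms of the numbers `2 ^ a * 3 ^ b`. -/
noncomputable def weightGroup : AddSubgroup ℝ := AddSubgroup.closure {Real.log 2, Real.log 3}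

theorem log_two_mem_weightGroup : Real.log 2 ∈ weightGroup :=
  AddSubgroup.subset_closure (by simp)

theorem log_three_mem_weightGroup : Real.log 3 ∈ weightGroup :=
  AddSubgroup.subset_closure (by simp)

theorem weight_mem_weightGroup (j k : Fin 5) : weight j k ∈ weightGroup := by
  unfold weight
  split_ifs
  · exact log_two_mem_weightGroup
  · exact neg_mem log_two_mem_weightGroup
  · exact log_three_mem_weightGroup
  · exact neg_mem log_three_mem_weightGroup
  · exact zero_mem _

/-- A rational value `m / d` would give `3 ^ m = 2 ^ d` with `d ≠ 0`, an odd number equal to an even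
one. -/
theorem irrational_log_two_div_log_three : Irrational (Real.log 2 / Real.log 3) := by
  have h2 : 0 < Real.log 2 := Real.log_pos (by norm_num)
  have h3 : 0 < Real.log 3 := Real.log_pos (by norm_num)
  rintro ⟨r, hr⟩
  have hr0 : 0 < r := by
    have : (0 : ℝ) < r := hr ▸ div_pos h2 h3
    exact_mod_cast this
  obtain ⟨m, hm⟩ := Int.eq_ofNat_of_zero_le (Rat.num_pos.2 hr0).le
  have hd : (r.den : ℝ) ≠ 0 := by exact_mod_cast r.den_nz
  have hr' : (r : ℝ) = m / r.den := by
    conv_lhs => rw [← Rat.num_div_den r]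
    rw [hm]; push_cast; rfl
  rw [hr', div_eq_div_iff hd h3.ne', ← Real.log_pow, mul_comm, ← Real.log_pow] at hr
  have hpow : (3 : ℝ) ^ m = 2 ^ r.den :=
    Real.log_injOn_pos (mem_Ioi.2 (by positivity)) (mem_Ioi.2 (by positivity)) hr
  have hpow' : 3 ^ m = 2 ^ r.den := by exact_mod_cast hpow
  have hodd : Odd (3 ^ m) := Odd.pow (by decide)
  rw [hpow'] at hodd
  exact (Nat.not_odd_iff_even.2 ((even_two).pow_of_ne_zero r.den_nz)) hodd

theorem dense_weightGroup : Dense (weightGroup : Set ℝ) :=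
  dense_addSubgroupClosure_pair_iff.2 irrational_log_two_div_log_three

theorem exists_height_eq_flow (x : Orbit ℤ) (i j : ℤ) :
    ∃ a ∈ weightGroup, height (x.1 j) = flow a (height (x.1 i)) := by
  obtain ⟨e, he0, he⟩ := IsStepIndex.exists_sum
    fun i => weight (idx (x.1 i)) (idx (x.1 (i + 1)))
  have hmem : ∀ i, e i ∈ weightGroup := by
    intro i
    induction i with
    | zero => rw [he0]; exact zero_mem _
    | succ n ih => rw [he]; exact add_mem ih (weight_mem_weightGroup _ _)
    | pred n ih =>
      have h := he (-(n : ℤ) - 1)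
      rw [sub_add_cancel] at h
      rw [eq_sub_of_add_eq h.symm]
      exact sub_mem ih (weight_mem_weightGroup _ _)
  refine ⟨-e i + e j, add_mem (neg_mem (hmem i)) (hmem j), ?_⟩
  rw [height_eq_flow_sum x he0 he, height_eq_flow_sum x he0 he i, flow_flow]
  congr 1; ring

end Weights

/-! ### Cutting, repeating and perturbing orbits. -/

section Splicing

/-- Follow `x` up to time `N`, then `y` from time `M` on. -/
def splice (x y : Orbit ℤ) (N M : ℤ) (h : x.1 N = y.1 M) : Orbit ℤ :=
  ⟨fun i => if i ≤ N then x.1 i else y.1 (i - N + M), fun i => by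
    rcases lt_trichotomy i N with h1 | rfl | h1
    · simp only [h1.le, Int.add_one_le_of_lt h1, if_true]
      exact x.2 i
    · simp only [le_refl, if_true, not_le.2 (lt_add_one i), if_false, h]
      rw [show i + 1 - i + M = M + 1 by ring]
      exact y.2 M
    · simp only [not_le.2 h1, not_le.2 (h1.trans (lt_add_one i)), if_false]
      rw [show i + 1 - N + M = i - N + M + 1 by ring]
      exact y.2 _⟩

theorem splice_of_le (x y : Orbit ℤ) {N M : ℤ} (h : x.1 N = y.1 M) {i : ℤ} (hi : i ≤ N) :
    (splice x y N M h).1 i = x.1 i := if_pos hi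

theorem splice_of_ge (x y : Orbit ℤ) {N M : ℤ} (h : x.1 N = y.1 M) {i : ℤ} (hi : N ≤ i) :
    (splice x y N M h).1 i = y.1 (i - N + M) := by
  rcases hi.eq_or_lt with rfl | hi
  · rw [splice_of_le x y h le_rfl, h, sub_self, zero_add]
  · exact if_neg (not_le.2 hi)

/-- Repeat the segment of `y` between the times `K` and `K + L`. -/
def periodize (y : Orbit ℤ) (K L : ℤ) (hL : 0 < L) (h : y.1 (K + L) = y.1 K) : Orbit ℤ :=
  ⟨fun i => y.1 (K + (i - K) % L), fun i => by
    have h0 := Int.emod_nonneg (i - K) hL.ne'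
    have h1 := Int.emod_lt_of_pos (i - K) hL
    have h2 : (i + 1 - K) % L = ((i - K) % L + 1) % L := by
      rw [Int.emod_add_emod]; congr 1; ring
    have hF := y.2 (K + (i - K) % L)
    beta_reduce
    rw [h2]
    -- Only the last step of a period wraps around; there `h` closes the loop.
    rcases (Int.add_one_le_of_lt h1).eq_or_lt with h3 | h3
    · rw [h3, Int.emod_self, add_zero, ← h]
      rwa [add_assoc, h3] at hF
    · rw [Int.emod_eq_of_lt (by omega) h3, ← add_assoc]
      exact hF⟩

theorem periodize_of_mem (y : Orbit ℤ) {K L : ℤ} (hL : 0 < L) (h : y.1 (K + L) = y.1 K) {i : ℤ}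
    (h1 : K ≤ i) (h2 : i < K + L) : (periodize y K L hL h).1 i = y.1 i := by
  change y.1 (K + (i - K) % L) = y.1 i
  rw [Int.emod_eq_of_lt (by omega) (by omega), add_sub_cancel]

theorem periodize_add (y : Orbit ℤ) {K L : ℤ} (hL : 0 < L) (h : y.1 (K + L) = y.1 K) (i : ℤ) :
    (periodize y K L hL h).1 (i + L) = (periodize y K L hL h).1 i := by
  change y.1 (K + (i + L - K) % L) = y.1 (K + (i - K) % L)
  rw [show i + L - K = i - K + L by ring, Int.add_emod_right]

/-- The image of an orbit under the power flow. -/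
noncomputable def flowOrbit (x : Orbit ℤ) (a : ℝ) : Orbit ℤ :=
  ⟨fun i => point (idx (x.1 i), flow a (height (x.1 i))), fun i => by
    obtain ⟨h1, h2⟩ := mem_F_iff.1 (x.2 i)
    refine point_mem_F.2 ⟨h1, ?_⟩
    rw [h2, flow_flow, flow_flow, add_comm]⟩

theorem flowOrbit_zero (x : Orbit ℤ) : flowOrbit x 0 = x :=
  Subtype.ext (funext fun i => by simp [flowOrbit, point_idx_height])

theorem continuous_flowOrbit (x : Orbit ℤ) : Continuous (flowOrbit x) := by
  refine Continuous.subtype_mk (continuous_pi fun i => ?_) _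
  exact continuous_point.comp (continuous_const.prodMk
    (continuous_flow.comp (continuous_id.prodMk continuous_const)))

theorem height_flowOrbit (x : Orbit ℤ) (a : ℝ) (i : ℤ) :
    height ((flowOrbit x a).1 i) = flow a (height (x.1 i)) := height_point _

end Splicing

/-! ### Realizing every weight of the group by a walk. -/

section Connections

/-- From every height of the `p`-th interval, in every sufficiently large number of steps, the
relation leads to the `q`-th interval with total weight `a`. -/
def Connects (p q : Fin 5) (a : ℝ) : Prop :=
  ∃ n₀ : ℕ, ∀ n ≥ n₀, ∀ t : I, ∃ u : Orbit ℤ, u.1 0 = point (p, t) ∧ u.1 n = point (q, flow a t)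

/-- The step is taken at once, and surplus time is spent waiting at its end under the identity
branch. -/
theorem Connects.of_linked {p q : Fin 5} (h : Linked p q) : Connects p q (weight p q) := by
  refine ⟨1, fun n hn t => ⟨⟨fun i => if i ≤ 0 then point (p, t) else
    point (q, flow (weight p q) t), fun i => ?_⟩, by simp, if_neg (by omega)⟩⟩
  rcases lt_trichotomy i 0 with h1 | rfl | h1
  · simp only [h1.le, Int.add_one_le_of_lt h1, if_true]
    exact mem_F_self _
  · exact point_mem_F.2 ⟨h, rfl⟩
  · simp only [not_le.2 h1, not_le.2 (h1.trans (lt_add_one i)), if_false]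
    exact mem_F_self _

theorem Connects.refl (p : Fin 5) : Connects p p 0 := by
  simpa using Connects.of_linked (Linked.refl p)

theorem Connects.trans {p q r : Fin 5} {a b : ℝ} (h1 : Connects p q a) (h2 : Connects q r b) :
    Connects p r (a + b) := by
  obtain ⟨n₁, h1⟩ := h1
  obtain ⟨n₂, h2⟩ := h2
  refine ⟨n₁ + n₂, fun n hn t => ?_⟩
  obtain ⟨u, hu0, hu⟩ := h1 n₁ le_rfl t
  obtain ⟨v, hv0, hv⟩ := h2 (n - n₁) (by omega) (flow a t)
  refine ⟨splice u v n₁ 0 (hu.trans hv0.symm), ?_, ?_⟩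
  · rw [splice_of_le _ _ _ (by omega), hu0]
  · rw [splice_of_ge _ _ _ (by omega), show (n : ℤ) - n₁ + 0 = ((n - n₁ : ℕ) : ℤ) by omega, hv,
      flow_flow]

theorem Connects.congr {p q : Fin 5} {a b : ℝ} (h : Connects p q a) (hab : a = b) :
    Connects p q b := hab ▸ h

/-- Interval 2 lies between the two sources of weight. The trip 2-1-2 costs `-log 2` and each detour
1-0-1 adds `log 2`; the trip 2-3-2 gains `log 3` and each detour 3-4-3 subtracts `log 3`. Two
detours therefore reverse the sign of the plain trip. -/
theorem connects_two_two {a : ℝ} (ha : a ∈ weightGroup) : Connects 2 2 a := by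
  have h01 : Connects 0 1 0 := weight_0_1 ▸ Connects.of_linked (by decide)
  have h10 : Connects 1 0 (Real.log 2) := weight_1_0 ▸ Connects.of_linked (by decide)
  have h12 : Connects 1 2 0 := weight_1_2 ▸ Connects.of_linked (by decide)
  have h21 : Connects 2 1 (-Real.log 2) := weight_2_1 ▸ Connects.of_linked (by decide)
  have h23 : Connects 2 3 0 := weight_2_3 ▸ Connects.of_linked (by decide)
  have h32 : Connects 3 2 (Real.log 3) := weight_3_2 ▸ Connects.of_linked (by decide)
  have h34 : Connects 3 4 0 := weight_3_4 ▸ Connects.of_linked (by decide)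
  have h43 : Connects 4 3 (-Real.log 3) := weight_4_3 ▸ Connects.of_linked (by decide)
  have h11 := h10.trans h01
  have h33 := h34.trans h43
  suffices h : Connects 2 2 a ∧ Connects 2 2 (-a) from h.1
  refine AddSubgroup.closure_induction (p := fun a _ => Connects 2 2 a ∧ Connects 2 2 (-a))
    ?_ ?_ ?_ ?_ ha
  · rintro _ (rfl | rfl)
    · exact ⟨(((h21.trans h11).trans h11).trans h12).congr (by ring),
        (h21.trans h12).congr (by ring)⟩
    · exact ⟨(h23.trans h32).congr (by ring),
        (((h23.trans h33).trans h33).trans h32).congr (by ring)⟩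
  · exact ⟨Connects.refl 2, (Connects.refl 2).congr neg_zero.symm⟩
  · intro a b _ _ ha hb
    exact ⟨ha.1.trans hb.1, (ha.2.trans hb.2).congr (by ring)⟩
  · intro a _ ha
    exact ⟨ha.2, ha.1.congr (by ring)⟩

theorem exists_connects_two (p : Fin 5) :
    (∃ a ∈ weightGroup, Connects p 2 a) ∧ ∃ a ∈ weightGroup, Connects 2 p a := by
  have key : ∀ {p q : Fin 5}, Linked p q → ∃ a ∈ weightGroup, Connects p q a := fun h =>
    ⟨_, weight_mem_weightGroup _ _, Connects.of_linked h⟩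
  have step : ∀ {p q r : Fin 5}, (∃ a ∈ weightGroup, Connects p q a) →
      (∃ a ∈ weightGroup, Connects q r a) → ∃ a ∈ weightGroup, Connects p r a :=
    fun ⟨a, ha, h⟩ ⟨b, hb, h'⟩ => ⟨a + b, add_mem ha hb, h.trans h'⟩
  rcases fin_five_cases p with rfl | rfl | rfl | rfl | rfl
  · exact ⟨step (q := 1) (key (by decide)) (key (by decide)),
      step (q := 1) (key (by decide)) (key (by decide))⟩
  · exact ⟨key (by decide), key (by decide)⟩
  · exact ⟨key (by decide), key (by decide)⟩
  · exact ⟨key (by decide), key (by decide)⟩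
  · exact ⟨step (q := 3) (key (by decide)) (key (by decide)),
      step (q := 3) (key (by decide)) (key (by decide))⟩

/-- Travel via interval 2, where the weights of the two outer legs are compensated. -/
theorem connects_of_mem (p q : Fin 5) {a : ℝ} (ha : a ∈ weightGroup) : Connects p q a := by
  obtain ⟨b, hb, h1⟩ := (exists_connects_two p).1
  obtain ⟨c, hc, h2⟩ := (exists_connects_two q).2
  exact ((h1.trans (connects_two_two (sub_mem (sub_mem ha hb) hc))).trans h2).congr (by ring)

/-- Two points whose heights differ by an element of the weight group are joined by orbits of
every sufficiently large length. -/
theorem exists_orbit_of_height_eq {x y : fiveIntervals} {a : ℝ} (ha : a ∈ weightGroup)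
    (h : height y = flow a (height x)) :
    ∃ n₀ : ℕ, ∀ n ≥ n₀, ∃ u : Orbit ℤ, u.1 0 = x ∧ u.1 n = y := by
  obtain ⟨n₀, hn⟩ := connects_of_mem (idx x) (idx y) ha
  refine ⟨n₀, fun n hn' => ?_⟩
  obtain ⟨u, h0, h1⟩ := hn n hn' (height x)
  exact ⟨u, by rw [h0, point_idx_height], by rw [h1, ← h, point_idx_height]⟩

end Connections

/-! ### Mixing, periodic points and the shift maps. -/

section Dynamics

theorem exists_forall_mem_of_isOpen {U : Set (Orbit ℤ)} (hU : IsOpen U) {x : Orbit ℤ}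
    (hx : x ∈ U) :
    ∃ N : ℕ, ∀ y : Orbit ℤ, (∀ i : ℤ, -N ≤ i → i ≤ N → y.1 i = x.1 i) → y ∈ U := by
  obtain ⟨V, hV, rfl⟩ := isOpen_induced_iff.1 hU
  obtain ⟨J, u, hu, hJ⟩ := isOpen_pi_iff.1 hV x.1 hx
  refine ⟨J.sup Int.natAbs, fun y hy => hJ fun i hi => ?_⟩
  have hle : i.natAbs ≤ J.sup Int.natAbs := Finset.le_sup (f := Int.natAbs) hi
  rw [hy i (by omega) (by omega)]
  exact (hu i hi).2

/-- Heights 0 and 1 are fixed by the flow, so `exists_flow_eq` needs them avoided; varying only the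
height coordinate does this. -/
theorem exists_mem_height_ne {U : Set (Orbit ℤ)} (hU : IsOpen U) (hne : U.Nonempty) :
    ∃ x ∈ U, height (x.1 0) ≠ 0 ∧ height (x.1 0) ≠ 1 := by
  obtain ⟨x, hx⟩ := hne
  let Φ : Orbit ℤ ≃ₜ Walk ℤ × I := (isHomeomorph_iff_continuous_bijective.2
    ⟨continuous_orbitCoords, orbitCoords_bijective⟩).homeomorph
  have hcont : Continuous fun t : I => Φ.symm ((Φ x).1, t) :=
    Φ.symm.continuous.comp (continuous_const.prodMk continuous_id)
  have hd : Dense ((univ : Set I) \ {0, 1}) := dense_univ.sdiff_finite (toFinite {0, 1})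
  obtain ⟨t, ht, -, ht'⟩ := hd.inter_open_nonempty _ (hU.preimage hcont)
    ⟨(Φ x).2, by change Φ.symm (Φ x) ∈ U; rwa [Φ.symm_apply_apply]⟩
  have h : height ((Φ.symm ((Φ x).1, t)).1 0) = t :=
    congrArg Prod.snd (Φ.apply_symm_apply ((Φ x).1, t))
  refine ⟨_, ht, ?_⟩
  rw [h]
  simpa using ht'

theorem shift_iterate_apply (n : ℕ) (x : Mahavier F) (i : ℤ) :
    ((shift F)^[n] x).1 i = x.1 (i + n) := by
  induction n generalizing x with
  | zero => simp
  | succ n ih =>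
    rw [Function.iterate_succ_apply, ih]
    change x.1 (i + n + 1) = _
    push_cast; rw [add_assoc]

theorem isMixingMap_shift : IsMixingMap (shift F) := by
  intro U V hU hV hU' hV'
  obtain ⟨x, hx, hx0, hx1⟩ := exists_mem_height_ne (U := U) hU hU'
  obtain ⟨y, hy, hy0, hy1⟩ := exists_mem_height_ne (U := V) hV hV'
  obtain ⟨b, hb⟩ := exists_flow_eq hx0 hx1 hy0 hy1
  have hcont : Continuous fun a => flowOrbit y (a - b) :=
    (continuous_flowOrbit y).comp (continuous_id.sub continuous_const)
  -- The weight `b` from `x` to `y` need not lie in the group; density gives a nearby `a` that does,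
  -- while the perturbed `y` stays in `V`.
  obtain ⟨a, haV, ha⟩ := dense_weightGroup.inter_open_nonempty _ (IsOpen.preimage hcont hV)
    ⟨b, by change flowOrbit y (b - b) ∈ V; rwa [sub_self, flowOrbit_zero]⟩
  set z := flowOrbit y (a - b) with hz
  obtain ⟨N, hN⟩ := exists_forall_mem_of_isOpen (U := U) hU hx
  obtain ⟨M, hM⟩ := exists_forall_mem_of_isOpen (U := V) (x := z) hV haV
  obtain ⟨c, hc, hcx⟩ := exists_height_eq_flow x N 0
  obtain ⟨d, hd, hdz⟩ := exists_height_eq_flow z 0 (-M)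
  have hz0 : height (z.1 0) = flow a (height (x.1 0)) := by
    rw [hz, height_flowOrbit, ← hb, flow_flow]; congr 1; ring
  -- The total weight goes from time `N` of `x` back to its time 0, across by `a`, then to time `-M`
  -- of `z`.
  obtain ⟨n₀, hn₀⟩ := exists_orbit_of_height_eq (x := x.1 N) (y := z.1 (-M))
    (add_mem (add_mem hc ha) hd) (by rw [hdz, hz0, hcx, flow_flow, flow_flow, add_assoc])
  -- The bridge occupies times `N` to `n - M`, so `n` shifts bring the block of `z` back to its own
  -- position.
  refine ⟨n₀ + N + M, fun n _ hn => ?_⟩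
  obtain ⟨u, hu0, hu⟩ := hn₀ (n - N - M) (by omega)
  have h1 : (splice x u N 0 hu0.symm).1 (n - M) = z.1 (-M) := by
    rw [splice_of_ge _ _ _ (by omega), ← hu,
      show (n : ℤ) - M - N + 0 = ((n - N - M : ℕ) : ℤ) by omega]
  refine ⟨_, mem_image_of_mem _ (hN (splice (splice x u N 0 hu0.symm) z (n - M) (-M) h1)
    fun i _ hi => ?_), hM _ fun i hi _ => ?_⟩
  · rw [splice_of_le _ _ _ (by omega), splice_of_le _ _ _ hi]
  · refine (shift_iterate_apply n _ i).trans ?_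
    rw [splice_of_ge _ _ _ (by omega), show i + n - (n - M) + -M = i by ring]

theorem dense_periodicPts_shift : Dense (Function.periodicPts (shift F)) := by
  refine dense_iff_inter_open.2 fun U hU ⟨(x : Orbit ℤ), hx⟩ => ?_
  obtain ⟨N, hN⟩ := exists_forall_mem_of_isOpen (U := U) hU hx
  obtain ⟨a, ha, hax⟩ := exists_height_eq_flow x N (-N)
  obtain ⟨n₀, hn₀⟩ := exists_orbit_of_height_eq ha hax
  -- The extra step keeps time `N` strictly inside the period that starts at `-N`.
  obtain ⟨u, hu0, hu⟩ := hn₀ (n₀ + 1) n₀.le_succ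
  have hle : ∀ i : ℤ, i ≤ N → (splice x u N 0 hu0.symm).1 i = x.1 i := fun i hi =>
    splice_of_le _ _ _ hi
  have hper : (splice x u N 0 hu0.symm).1 (-N + (2 * N + n₀ + 1 : ℕ)) =
      (splice x u N 0 hu0.symm).1 (-N) := by
    rw [splice_of_ge _ _ _ (by omega), hle _ (by omega), ← hu,
      show -(N : ℤ) + (2 * N + n₀ + 1 : ℕ) - N + 0 = ((n₀ + 1 : ℕ) : ℤ) by omega]
  refine ⟨periodize _ (-N) (2 * N + n₀ + 1 : ℕ) (by omega) hper, hN _ fun i h1 h2 => ?_,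
    2 * N + n₀ + 1, by omega, Subtype.ext (funext fun i => ?_)⟩
  · rw [periodize_of_mem _ _ _ h1 (by omega), hle i h2]
  · exact (shift_iterate_apply _ _ i).trans (periodize_add _ _ _ i)

/-- The one-sided sequence of the coordinates with non-negative index. -/
def restrictPlus (x : Mahavier F) : MahavierPlus F :=
  ⟨fun n => x.1 n, fun n => x.2 n⟩

theorem continuous_restrictPlus : Continuous restrictPlus := by
  have h : Continuous fun x : Orbit ℤ => (⟨fun n => x.1 n, fun n => x.2 n⟩ : Orbit ℕ) := by
    refine Continuous.subtype_mk (continuous_pi fun n => ?_) _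
    exact (continuous_apply _).comp continuous_subtype_val
  exact h

theorem restrictPlus_surjective : Function.Surjective restrictPlus := by
  intro x
  -- The past is filled with the constant `x 0`, allowed by the identity branch.
  refine ⟨⟨fun i => x.1 i.toNat, fun i => ?_⟩, rfl⟩
  change (x.1 i.toNat, x.1 (i + 1).toNat) ∈ F
  rcases le_or_gt 0 i with h | h
  · have h1 : (i + 1).toNat = i.toNat + 1 := by omega
    exact h1 ▸ x.2 _
  · have h1 : (i + 1).toNat = i.toNat := by omega
    exact h1 ▸ mem_F_self _

theorem continuous_shift_orbit (ι : Type) [Add ι] [One ι] : Continuous fun x : Orbit ι =>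
    (⟨fun i => x.1 (i + 1), fun i => x.2 (i + 1)⟩ : Orbit ι) := by
  refine Continuous.subtype_mk (continuous_pi fun i => ?_) _
  exact (continuous_apply _).comp continuous_subtype_val

theorem continuous_shift : Continuous (shift F) := continuous_shift_orbit ℤ

theorem continuous_shiftPlus : Continuous (shiftPlus F) := continuous_shift_orbit ℕ

theorem continuous_shiftStar : Continuous shiftStar :=
  continuous_shift.quotient_map' _

theorem continuous_shiftPlusStar : Continuous shiftPlusStar :=
  continuous_shiftPlus.quotient_map' _

theorem shiftStar_bijective : Function.Bijective shiftStar := by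
  constructor
  · intro a b
    refine Quotient.inductionOn₂ a b fun x y h => Quotient.sound ?_
    rcases Quotient.exact h with h | h
    · refine Or.inl (Subtype.ext (funext fun i => ?_))
      have := congrFun (congrArg Subtype.val h) (i - 1)
      simpa [shift] using this
    · refine Or.inr fun k => ?_
      have := h (k - 1)
      simpa [shift] using this
  · refine fun b => Quotient.inductionOn b fun y => ?_
    refine ⟨Quotient.mk _ ⟨fun i => y.1 (i - 1), fun i => ?_⟩, congrArg (Quotient.mk _)
      (Subtype.ext (funext fun i => ?_))⟩
    · have := y.2 (i - 1)
      rwa [show i - 1 + 1 = i + 1 - 1 by ring] at this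
    · simp [shift]

/-- The sequences `3, 3, 3, …` and `1, 3, 3, …` have the same shift, and neither is collapsed since
their heights are 1. -/
theorem not_injective_shiftPlusStar : ¬ Function.Injective shiftPlusStar := by
  intro hinj
  have hF : (point (0, 1), point (1, 1)) ∈ F := point_mem_F.2 ⟨by decide, by simp⟩
  let x : MahavierPlus F := ⟨fun _ => point (1, 1), fun _ => mem_F_self _⟩
  let y : MahavierPlus F := ⟨fun n => if n = 0 then point (0, 1) else point (1, 1), fun n => by
    cases n with
    | zero => exact hF
    | succ n => exact mem_F_self _⟩
  have hxy : shiftPlusStar (Quotient.mk _ x) = shiftPlusStar (Quotient.mk _ y) := rfl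
  rcases Quotient.exact (hinj hxy) with h | h
  · have h0 : point (1, 1) = point (0, 1) := congrFun (congrArg Subtype.val h) 0
    exact absurd (congrArg Prod.fst (point_injective h0)) (by decide)
  · exact one_ne_zero (point_mem_leftEnds.1 (h 0).1)

end Dynamics

end CantorFanChaos

/-! ### Transport to an arbitrary Cantor fan. -/

open CantorFanChaos
theorem mainTheorem2 (C : Type*) [TopologicalSpace C] (hC : IsCantorFan C) :
    (IsHomeomorph f₁ ∧ IsHomeomorph f₂ ∧ IsHomeomorph f₃) ∧
    (∃ f : C → C, Continuous f ∧ ¬ IsHomeomorph f ∧ IsMixingMap f ∧ IsDevaneyChaotic f ∧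
      ∃ φ : QuotientPlus ≃ₜ C, ∀ z, φ (shiftPlusStar z) = f (φ z)) ∧
    (∃ h : C ≃ₜ C, IsMixingMap h ∧ IsDevaneyChaotic h ∧
      ∃ φ : QuotientTwoSided ≃ₜ C, ∀ z, φ (shiftStar z) = h (φ z)) := by
  obtain ⟨e⟩ := hC
  refine ⟨⟨isHomeomorph_f₁, isHomeomorph_f₂, isHomeomorph_f₃⟩, ?_, ?_⟩
  · obtain ⟨φ₀⟩ := nonempty_quotientPlus_homeomorph_fan
    let φ : QuotientPlus ≃ₜ C := φ₀.trans e.symm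
    have hconj : ∀ z, φ (shiftPlusStar z) = (φ ∘ shiftPlusStar ∘ φ.symm) (φ z) := by simp
    -- The one-sided quotient system is a factor of the two-sided shift, so the dynamics already
    -- proved there carry over.
    have hc : Continuous (φ ∘ Quotient.mk collapsePlus ∘ restrictPlus) :=
      φ.continuous.comp (continuous_quotient_mk'.comp continuous_restrictPlus)
    have hs : Function.Surjective (φ ∘ Quotient.mk collapsePlus ∘ restrictPlus) :=
      φ.surjective.comp (Quotient.mk_surjective.comp restrictPlus_surjective)
    have hπ : Function.Semiconj (φ ∘ Quotient.mk collapsePlus ∘ restrictPlus) (shift F)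
        (φ ∘ shiftPlusStar ∘ φ.symm) := fun x => hconj (Quotient.mk _ (restrictPlus x))
    have hmix := isMixingMap_shift.of_semiconj hc hs hπ
    refine ⟨_, φ.continuous.comp (continuous_shiftPlusStar.comp φ.symm.continuous), fun h => ?_,
      hmix, ⟨hmix.isTransitiveMap, dense_periodicPts_of_semiconj dense_periodicPts_shift hc hs hπ⟩,
      φ, hconj⟩
    refine not_injective_shiftPlusStar fun a b hab => φ.injective (h.injective ?_)
    rw [← hconj, ← hconj, hab]
  · obtain ⟨φ₀⟩ := nonempty_quotientTwoSided_homeomorph_fan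
    let φ : QuotientTwoSided ≃ₜ C := φ₀.trans e.symm
    have : CompactSpace (Mahavier F) := inferInstanceAs (CompactSpace (Orbit ℤ))
    have : CompactSpace C := φ.compactSpace
    have : T2Space C := e.symm.t2Space
    have hhom : IsHomeomorph (φ ∘ shiftStar ∘ φ.symm) := isHomeomorph_iff_continuous_bijective.2
      ⟨φ.continuous.comp (continuous_shiftStar.comp φ.symm.continuous),
        φ.bijective.comp (shiftStar_bijective.comp φ.symm.bijective)⟩
    let h : C ≃ₜ C := hhom.homeomorph
    have hconj : ∀ z, φ (shiftStar z) = h (φ z) := fun z => by simp [h]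
    have hc : Continuous (φ ∘ Quotient.mk collapse) :=
      φ.continuous.comp continuous_quotient_mk'
    have hs : Function.Surjective (φ ∘ Quotient.mk collapse) :=
      φ.surjective.comp Quotient.mk_surjective
    have hπ : Function.Semiconj (φ ∘ Quotient.mk collapse) (shift F) h :=
      fun x => hconj (Quotient.mk _ x)
    have hmix := isMixingMap_shift.of_semiconj hc hs hπ
    exact ⟨h, hmix, ⟨hmix.isTransitiveMap,
      dense_periodicPts_of_semiconj dense_periodicPts_shift hc hs hπ⟩, φ, hconj⟩
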